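/- Let $\mathbb{F}_\omega$ be the free group on the letters $\{a_i\}_{i\in\mathbb{N}}$. Let $\mathscr{G}$ be the space of marked groups, that is, the set of normal subgroups $N$ of $\mathbb{F}_\omega$ with the topology of a (closed) subspace of the Cantor space $2^{\mathbb{F}_\omega}$, where $N\in\mathscr{G}$ is identified with the group $\mathbb{F}_\omega/N$ marked by the images of the letters $a_i$. Let $\mathscr{G}_{fg}\subseteq\mathscr{G}$ be the space of finitely generated marked groups, that is, the set of all $N\in\mathscr{G}$ for which there is $m\geq 1$ with $a_i\in N$ for all $i\geq m$; its Borel sets are the sets $\mathscr{G}_{fg}\cap B$ with $B$ Borel in $\mathscr{G}$, and with them it is a standard Borel space. Let $\mathrm{EG}$ be the class of elementary amenable groups, that is, the smallest class of countable groups, closed under isomorphism, that contains all finite groups and all countable abelian groups and is closed under group extensions, countable increasing unions, subgroups and quotients; write also $\mathrm{EG}$ for the set of $N\in\mathscr{G}$ with $\mathbb{F}_\omega/N$ elementary amenable. A subset $A$ of a standard Borel space $Y$ is analytic if it is the projection to $Y$ of a Borel subset of $X\times Y$ for some uncountable standard Borel space $X$, and co-analytic if $Y\setminus A$ is analytic.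 Theorem. $\mathrm{EG}$ is co-analytic and not Borel in $\mathscr{G}$, and $\mathrm{EG}\cap\mathscr{G}_{fg}$ is co-analytic and not Borel in $\mathscr{G}_{fg}$. -/

import Mathlib

/-- The space of marked groups: the normal subgroups `N` of the free group on the letters
`a 0, a 1, a 2, …`, each standing for the group `F_ω ⧸ N` marked by the images of the letters. -/
def MarkedGroup : Type := {N : Subgroup (FreeGroup ℕ) // N.Normal}

namespace MarkedGroup

/-- The normal subgroup of the free group that defines a marked group. -/
def ker (G : MarkedGroup) : Subgroup (FreeGroup ℕ) := G.1

instance (G : MarkedGroup) : G.ker.Normal := G.2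

/-- The underlying group `F_ω ⧸ N` of a marked group. -/
abbrev Carrier (G : MarkedGroup) : Type := FreeGroup ℕ ⧸ G.ker

open Classical in
/-- The indicator function of the defining normal subgroup, a point of the Cantor space
`2 ^ F_ω` (where `Bool` is discrete). -/
noncomputable def toCantor (G : MarkedGroup) : FreeGroup ℕ → Bool := fun w => decide (w ∈ G.ker)

/-- The topology of a subspace of the Cantor space `2 ^ F_ω`. -/
noncomputable instance : TopologicalSpace MarkedGroup := TopologicalSpace.induced toCantor inferInstance

noncomputable instance : MeasurableSpace MarkedGroup := borel MarkedGroup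

instance : BorelSpace MarkedGroup := ⟨rfl⟩

/-- The finitely generated marked groups: those `N` for which there is `m ≥ 1` with `a i ∈ N` for
all `i ≥ m`. As a type it carries the induced Borel structure. -/
def finGen : Set MarkedGroup := {G | ∃ m : ℕ, 1 ≤ m ∧ ∀ i, m ≤ i → FreeGroup.of i ∈ G.ker}

theorem toCantor_injective : Function.Injective toCantor := by
  intro G H h
  apply Subtype.ext
  ext w
  have := congrFun h w
  exact decide_eq_decide.mp this

theorem isClosed_forall_aux {X ι : Type} [TopologicalSpace X] {p : ι → X → Prop}
    (h : ∀ i, IsClosed {x | p i x}) : IsClosed {x | ∀ i, p i x} := by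
  have : {x | ∀ i, p i x} = ⋂ i, {x | p i x} := by ext x; simp
  rw [this]
  exact isClosed_iInter h

theorem isClosed_range_toCantor : IsClosed (Set.range toCantor) := by
  have h : Set.range toCantor = {x : FreeGroup ℕ → Bool | x 1 = true ∧
      (∀ a b, x a = true → x b = true → x (a * b) = true) ∧
      (∀ a, x a = true → x a⁻¹ = true) ∧
      ∀ a g, x a = true → x (g * a * g⁻¹) = true} := by
    ext x
    constructor
    · rintro ⟨G, rfl⟩
      simp only [toCantor, decide_eq_true_eq, Set.mem_ofPred_eq]
      exact ⟨G.ker.one_mem, fun a b => G.ker.mul_mem, fun a => G.ker.inv_mem,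
        fun a g h => G.2.conj_mem a h g⟩
    · rintro ⟨h1, hm, hi, hc⟩
      refine ⟨⟨{ carrier := {w | x w = true}, one_mem' := h1, mul_mem' := fun ha hb => hm _ _ ha hb,
                 inv_mem' := fun ha => hi _ ha }, ⟨fun a ha g => hc a g ha⟩⟩, ?_⟩
      funext w
      rw [Bool.eq_iff_iff]
      exact @decide_eq_true_iff _ (Classical.propDecidable _)
  have hcl : ∀ a : FreeGroup ℕ, IsClopen {x : FreeGroup ℕ → Bool | x a = true} := fun a =>
    (isClopen_discrete {true}).preimage (continuous_apply a)
  have himp : ∀ (p q : (FreeGroup ℕ → Bool) → Prop), IsClopen {x | p x} → IsClopen {x | q x} →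
      IsClopen {x | p x → q x} := by
    intro p q hp hq
    have : {x | p x → q x} = {x | p x}ᶜ ∪ {x | q x} := by ext x; simp [imp_iff_not_or]
    rw [this]
    exact hp.compl.union hq
  rw [h]
  refine (hcl 1).1.and (IsClosed.and ?_ (IsClosed.and ?_ ?_))
  · exact isClosed_forall_aux fun a => isClosed_forall_aux fun b =>
      (himp _ _ (hcl a) (himp _ _ (hcl b) (hcl (a * b)))).1
  · exact isClosed_forall_aux fun a => (himp _ _ (hcl a) (hcl a⁻¹)).1
  · exact isClosed_forall_aux fun a => isClosed_forall_aux fun g =>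
      (himp _ _ (hcl a) (hcl (g * a * g⁻¹))).1

theorem isClosedEmbedding_toCantor : Topology.IsClosedEmbedding toCantor :=
  ⟨⟨⟨rfl⟩, toCantor_injective⟩, isClosed_range_toCantor⟩

instance : PolishSpace MarkedGroup :=
  haveI : PolishSpace (FreeGroup ℕ → Bool) := { }
  isClosedEmbedding_toCantor.polishSpace

theorem measurableSet_finGen : MeasurableSet finGen := by
  have h : finGen = ⋃ m : ℕ, ⋃ _ : 1 ≤ m, ⋂ i : ℕ, ⋂ _ : m ≤ i,
      {G : MarkedGroup | toCantor G (FreeGroup.of i) = true} := by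
    ext G
    simp [finGen, toCantor]
  rw [h]
  refine MeasurableSet.iUnion fun m => MeasurableSet.iUnion fun _ => MeasurableSet.iInter fun i =>
    MeasurableSet.iInter fun _ => IsClosed.measurableSet ?_
  exact (isClosed_discrete {true}).preimage
    ((continuous_apply (FreeGroup.of i)).comp isClosedEmbedding_toCantor.continuous)

instance : StandardBorelSpace finGen := measurableSet_finGen.standardBorel

end MarkedGroup

/-- The class of elementary amenable groups: the smallest class of countable groups that contains
the finite groups and the countable abelian groups and is closed under extensions, countable
increasing unions, subgroups and quotients (the last two up to isomorphism). -/
inductive IsElementaryAmenable : (G : Type) → [Group G] → Prop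
  | of_finite (G : Type) [Group G] [Finite G] : IsElementaryAmenable G
  | of_abelian (G : Type) [Group G] [Countable G] (hcomm : ∀ a b : G, a * b = b * a) :
      IsElementaryAmenable G
  | of_extension (G : Type) [Group G] (N : Subgroup G) [N.Normal]
      (hN : IsElementaryAmenable N) (hQ : IsElementaryAmenable (G ⧸ N)) : IsElementaryAmenable G
  | of_iUnion (G : Type) [Group G] (H : ℕ → Subgroup G) (hmono : Monotone H)
      (hunion : ∀ g : G, ∃ n, g ∈ H n) (hH : ∀ n, IsElementaryAmenable (H n)) :
      IsElementaryAmenable G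
  | of_injective (G H : Type) [Group G] [Group H] (f : H →* G) (hf : Function.Injective f)
      (hG : IsElementaryAmenable G) : IsElementaryAmenable H
  | of_surjective (G Q : Type) [Group G] [Group Q] (f : G →* Q) (hf : Function.Surjective f)
      (hG : IsElementaryAmenable G) : IsElementaryAmenable Q

/-- The set of elementary amenable marked groups. -/
def elementaryAmenableMarkedGroups : Set MarkedGroup := {G | IsElementaryAmenable G.Carrier}

/-- A subset of a standard Borel space `Y` is analytic if it is the projection of a Borel subset
of `X × Y` for some uncountable standard Borel space `X`. -/
def IsAnalyticSubset {Y : Type} [MeasurableSpace Y] [StandardBorelSpace Y] (A : Set Y) : Prop :=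
  ∃ (X : Type) (_ : MeasurableSpace X) (_ : StandardBorelSpace X) (_ : Uncountable X)
    (B : Set (X × Y)), MeasurableSet B ∧ Prod.snd '' B = A

/-- A subset of a standard Borel space is co-analytic if its complement is analytic. -/
def IsCoanalyticSubset {Y : Type} [MeasurableSpace Y] [StandardBorelSpace Y] (C : Set Y) : Prop :=
  IsAnalyticSubset Cᶜ

/-! Failure of elementary amenability in a countable group has a countable certificate, a law
descent (`IsLawDescent`): a sequence of nontrivial finitely generated subgroups, each generated by
values on its predecessor of commutator words that are laws in the symmetric groups of degree at
most `n`. By Cayley a finite group stops a descent, an abelian group stops it at once, and the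
closure operations of EG hand it to a constituent (`not_isLawDescent`). Conversely, if a finitely
generated group is not in EG, neither is its verbal subgroup for these words (`of_map_lawSubgroup`),
hence neither is some finitely generated subgroup of that one, and this iterates
(`exists_isLawDescent`). The words of a descent are coded by a point of Baire space and the
conditions on them are Borel, so EG is co-analytic.

For the other half, a set of nodes `T` is sent in a Borel way to a group on two generators. The
group of a node `s` acts on words over `ℤ × ℕ`; it is generated by the translation `t` of the first
letter and by `b_s`, which keeps the first letter and, for each child `s ++ [n]` in `T`, acts on the
rest as `b_{s ++ [n]}` after `(0, n)` and as `t` after `(n + 1, n)`. Suitable commutators with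
factorial powers of `t` are laws and act after `(0, n)` as the generators of the child group, so a
branch yields a descent. Without a branch, induction over the nodes applies: translates of `b_s`
commute outside finitely many coordinates, so they generate a group that is abelian modulo finite
support, and `t` only adds a cyclic quotient. Thus the group is in EG exactly when `T` has no
branch, and a diagonal argument shows that this is not a Borel condition. -/

namespace IsElementaryAmenable

/-! ### Closure properties of elementary amenable groups -/

theorem of_mulEquiv {G H : Type} [Group G] [Group H] (e : G ≃* H) (hG : IsElementaryAmenable G) :
    IsElementaryAmenable H :=
  of_surjective G H e.toMonoidHom e.surjective hG

/-- An extension presented by a homomorphism. -/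
theorem of_ker_range {G H : Type} [Group G] [Group H] (f : G →* H)
    (hk : IsElementaryAmenable f.ker) (hr : IsElementaryAmenable f.range) :
    IsElementaryAmenable G :=
  of_extension G f.ker hk (of_mulEquiv (QuotientGroup.quotientKerEquivRange f).symm hr)

theorem mono {G : Type} [Group G] {H K : Subgroup G} (h : H ≤ K) (hK : IsElementaryAmenable K) :
    IsElementaryAmenable H :=
  of_injective K H (Subgroup.inclusion h) (Subgroup.inclusion_injective h) hK

/-- A group with an injective homomorphism into an elementary amenable subgroup. -/
theorem of_forall_mem {G H : Type} [Group G] [Group H] {K : Subgroup G} (f : H →* G)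
    (hf : Function.Injective f) (hmem : ∀ h, f h ∈ K) (hK : IsElementaryAmenable K) :
    IsElementaryAmenable H :=
  of_injective K H (f.codRestrict K hmem) (fun _ _ h => hf (congrArg Subtype.val h)) hK

theorem prod {G H : Type} [Group G] [Group H] (hG : IsElementaryAmenable G)
    (hH : IsElementaryAmenable H) : IsElementaryAmenable (G × H) := by
  refine of_ker_range (MonoidHom.fst G H) ?_ ?_
  · refine of_injective H _ ((MonoidHom.snd G H).comp (Subgroup.subtype _)) ?_ hH
    rintro ⟨⟨a, b⟩, ha⟩ ⟨⟨c, d⟩, hc⟩ h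
    rw [MonoidHom.mem_ker] at ha hc
    simp only [MonoidHom.coe_fst] at ha hc
    simp only [MonoidHom.coe_comp, Function.comp_apply, Subgroup.subtype_apply,
      MonoidHom.coe_snd] at h
    simp [ha, hc, h]
  · exact of_injective G _ (Subgroup.subtype _) (Subgroup.subtype_injective _) hG

/-- A group with countably many homomorphisms to elementary amenable groups that separate the
points, only finitely many of which are nontrivial at each element, is elementary amenable. -/
theorem of_finite_support {G : Type} [Group G] {Q : ℕ → Type} [∀ i, Group (Q i)]
    (f : ∀ i, G →* Q i) (hf : ∀ i, IsElementaryAmenable (f i).range)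
    (hinj : ∀ g, (∀ i, f i g = 1) → g = 1) (hfin : ∀ g, ∃ n, ∀ i, n ≤ i → f i g = 1) :
    IsElementaryAmenable G := by
  -- `H 0` is trivial, and `f n` restricted to `H (n + 1)` has kernel inside `H n`.
  let H : ℕ → Subgroup G := fun n => ⨅ i : {i : ℕ // n ≤ i}, (f i).ker
  have hmem : ∀ n g, g ∈ H n ↔ ∀ i, n ≤ i → f i g = 1 := by
    intro n g
    simp [H, Subgroup.mem_iInf, MonoidHom.mem_ker]
  refine of_iUnion G H ?_ ?_ ?_
  · intro m n hmn g hg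
    rw [hmem] at hg ⊢
    exact fun i hi => hg i (hmn.trans hi)
  · intro g
    obtain ⟨n, hn⟩ := hfin g
    exact ⟨n, (hmem n g).2 hn⟩
  · intro n
    induction n with
    | zero =>
      have : Subsingleton (H 0) := by
        refine subsingleton_of_forall_eq 1 ?_
        rintro ⟨g, hg⟩
        exact Subtype.ext (hinj g fun i => (hmem 0 g).1 hg i (Nat.zero_le i))
      exact of_finite _
    | succ n ih =>
      refine of_ker_range ((f n).comp (H (n + 1)).subtype) ?_ (mono ?_ (hf n))
      · have hle : ∀ x : ((f n).comp (H (n + 1)).subtype).ker, ((x : H (n + 1)) : G) ∈ H n := by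
          rintro ⟨⟨g, hg⟩, hx⟩
          rw [hmem]
          intro i hi
          rcases hi.eq_or_lt with rfl | hi
          · exact hx
          · exact (hmem _ g).1 hg i hi
        exact of_forall_mem ((H (n + 1)).subtype.comp (Subgroup.subtype _))
          (Subtype.val_injective.comp Subtype.val_injective) hle ih
      · rintro _ ⟨g, rfl⟩
        exact ⟨g, rfl⟩

end IsElementaryAmenable

/-- The homomorphism from the free group that sends the letters to the entries of a list, and the
letters beyond the length of the list to `1`. -/
def evalList {G : Type} [Group G] (l : List G) : FreeGroup ℕ →* G :=
  FreeGroup.lift fun i => l.getD i 1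

theorem evalList_of {G : Type} [Group G] (l : List G) (i : ℕ) :
    evalList l (FreeGroup.of i) = l.getD i 1 := FreeGroup.lift_apply_of

theorem range_evalList_le {G : Type} [Group G] {l : List G} {H : Subgroup G}
    (h : ∀ g ∈ l, g ∈ H) : (evalList l).range ≤ H := by
  rw [evalList, FreeGroup.range_lift_eq_closure, Subgroup.closure_le]
  rintro _ ⟨i, rfl⟩
  rw [SetLike.mem_coe]
  beta_reduce
  by_cases hi : i < l.length
  · rw [List.getD_eq_getElem _ _ hi]
    exact h _ (List.getElem_mem hi)
  · rw [List.getD_eq_default _ _ (not_lt.1 hi)]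
    exact H.one_mem

theorem mem_range_evalList {G : Type} [Group G] {l : List G} {g : G} (h : g ∈ l) :
    g ∈ (evalList l).range := by
  obtain ⟨i, hi, rfl⟩ := List.getElem_of_mem h
  exact ⟨FreeGroup.of i, by rw [evalList_of, List.getD_eq_getElem _ _ hi]⟩

/-- A homomorphism from the free group that kills all but finitely many letters. -/
def IsFinitary {G : Type} [Group G] (φ : FreeGroup ℕ →* G) : Prop :=
  ∃ k, ∀ i, k ≤ i → φ (FreeGroup.of i) = 1

theorem isFinitary_evalList {G : Type} [Group G] (l : List G) : IsFinitary (evalList l) :=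
  ⟨l.length, fun i hi => by rw [evalList_of, List.getD_eq_default _ _ hi]⟩

theorem IsFinitary.comp {G H : Type} [Group G] [Group H] {φ : FreeGroup ℕ →* G}
    (h : IsFinitary φ) (f : G →* H) : IsFinitary (f.comp φ) := by
  obtain ⟨k, hk⟩ := h
  exact ⟨k, fun i hi => by simp [hk i hi]⟩

theorem IsFinitary.eq_evalList {G : Type} [Group G] {φ : FreeGroup ℕ →* G} (h : IsFinitary φ) :
    ∃ l : List G, φ = evalList l := by
  obtain ⟨k, hk⟩ := h
  refine ⟨(List.range k).map fun i => φ (FreeGroup.of i), ?_⟩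
  ext i
  rw [evalList_of]
  by_cases hi : i < k
  · rw [List.getD_eq_getElem _ _ (by simpa using hi)]
    simp
  · rw [List.getD_eq_default _ _ (by simpa using hi), hk i (not_lt.1 hi)]

/-- A countable group whose finitely generated subgroups are elementary amenable is elementary
amenable. -/
theorem IsElementaryAmenable.of_locally {G : Type} [Group G] [Countable G]
    (h : ∀ l : List G, IsElementaryAmenable (evalList l).range) : IsElementaryAmenable G := by
  obtain ⟨e, he⟩ := exists_surjective_nat G
  refine .of_iUnion G (fun n => (evalList ((List.range n).map e)).range) ?_ ?_ fun n => h _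
  · intro m n hmn
    refine range_evalList_le ?_
    intro g hg
    refine mem_range_evalList ?_
    simp only [List.mem_map, List.mem_range] at hg ⊢
    obtain ⟨i, hi, rfl⟩ := hg
    exact ⟨i, hi.trans_le hmn, rfl⟩
  · intro g
    obtain ⟨i, rfl⟩ := he g
    exact ⟨i + 1, mem_range_evalList (by simp only [List.mem_map, List.mem_range]; exact
      ⟨i, Nat.lt_succ_self i, rfl⟩)⟩

/-! ### Law descents as certificates of non-membership -/

/-- The words in the commutator subgroup that are laws in the symmetric groups of degree at
most `n`. -/
def lawSubgroup (n : ℕ) : Subgroup (FreeGroup ℕ) :=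
  commutator (FreeGroup ℕ) ⊓
    ⨅ m : {m : ℕ // m ≤ n}, ⨅ ψ : FreeGroup ℕ →* Equiv.Perm (Fin m), ψ.ker

theorem mem_lawSubgroup {n : ℕ} {w : FreeGroup ℕ} : w ∈ lawSubgroup n ↔
    w ∈ commutator (FreeGroup ℕ) ∧
      ∀ m, m ≤ n → ∀ ψ : FreeGroup ℕ →* Equiv.Perm (Fin m), ψ w = 1 := by
  simp [lawSubgroup, Subgroup.mem_inf, Subgroup.mem_iInf, MonoidHom.mem_ker]

theorem lawSubgroup_antitone : Antitone lawSubgroup := by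
  intro m n hmn w hw
  rw [mem_lawSubgroup] at hw ⊢
  exact ⟨hw.1, fun k hk => hw.2 k (hk.trans hmn)⟩

instance (n : ℕ) : (lawSubgroup n).Normal := by
  refine ⟨fun w hw g => ?_⟩
  rw [mem_lawSubgroup] at hw ⊢
  refine ⟨Subgroup.Normal.conj_mem inferInstance _ hw.1 g, fun m hm ψ => ?_⟩
  simp [hw.2 m hm ψ]

theorem map_mem_lawSubgroup {n : ℕ} {w : FreeGroup ℕ} (r : FreeGroup ℕ →* FreeGroup ℕ)
    (hc : w ∈ commutator (FreeGroup ℕ))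
    (h : ∀ m, m ≤ n → ∀ ψ : FreeGroup ℕ →* Equiv.Perm (Fin m), ψ (r w) = 1) :
    r w ∈ lawSubgroup n := by
  refine mem_lawSubgroup.2 ⟨?_, h⟩
  have : (commutator (FreeGroup ℕ)).map r ≤ commutator (FreeGroup ℕ) := by
    rw [commutator_def, Subgroup.map_commutator]
    exact Subgroup.commutator_mono le_top le_top
  exact this ⟨w, hc, rfl⟩

/-- `φ` sees only `k` letters, which have finitely many assignments to permutations of degree at
most `n`. Hence `φ.range` modulo the verbal subgroup is a quotient of a subgroup of an abelian group
times a finite one. -/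
theorem IsElementaryAmenable.of_map_lawSubgroup {G : Type} [Group G] {φ : FreeGroup ℕ →* G}
    (hφ : IsFinitary φ) (n : ℕ) (h : IsElementaryAmenable ((lawSubgroup n).map φ)) :
    IsElementaryAmenable φ.range := by
  obtain ⟨k, hk⟩ := hφ
  let ι := Σ m : {m : ℕ // m ≤ n}, (Fin k → Equiv.Perm (Fin m))
  let ext : ∀ i : ι, FreeGroup ℕ →* Equiv.Perm (Fin i.1) := fun i =>
    FreeGroup.lift fun j => if hj : j < k then i.2 ⟨j, hj⟩ else 1
  let D : FreeGroup ℕ →* Abelianization (FreeGroup ℕ) × (∀ i : ι, Equiv.Perm (Fin i.1)) :=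
    Abelianization.of.prod (MonoidHom.pi ext)
  have : Finite {m : ℕ // m ≤ n} := (Set.finite_Iic n).to_subtype
  have : Finite ι := inferInstance
  have : Countable (Abelianization (FreeGroup ℕ)) :=
    (QuotientGroup.mk_surjective (s := commutator (FreeGroup ℕ))).countable
  have hDr : IsElementaryAmenable
      (Abelianization (FreeGroup ℕ) × (∀ i : ι, Equiv.Perm (Fin i.1))) := by
    refine IsElementaryAmenable.prod (.of_abelian _ mul_comm) (.of_finite _)
  -- Deleting the letters from `k` on does not change values of `φ`, and it turns words killed by
  -- `D` into laws, since each `ψ.comp r` is a component of `ext`.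
  let r : FreeGroup ℕ →* FreeGroup ℕ :=
    FreeGroup.lift fun j => if j < k then FreeGroup.of j else 1
  have hφr : φ.comp r = φ := by
    ext j
    by_cases hj : j < k
    · simp [r, hj]
    · simp [r, hj, hk j (not_lt.1 hj)]
  have hker : ∀ w ∈ D.ker, φ w ∈ (lawSubgroup n).map φ := by
    intro w hw
    rw [MonoidHom.mem_ker, MonoidHom.prod_apply, Prod.mk_eq_one] at hw
    refine ⟨r w, map_mem_lawSubgroup r ?_ ?_, by rw [← MonoidHom.comp_apply, hφr]⟩
    · rw [← Abelianization.ker_of]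
      exact hw.1
    · intro m hm ψ
      have h1 := congrFun hw.2 ⟨⟨m, hm⟩, fun j => ψ (FreeGroup.of j)⟩
      refine Eq.trans ?_ h1
      rw [← MonoidHom.comp_apply, MonoidHom.pi_apply]
      refine DFunLike.congr_fun (FreeGroup.ext_hom _ _ fun j => ?_) w
      by_cases hj : j < k
      · simp [r, ext, hj]
      · simp [r, ext, hj]
  let V : Subgroup φ.range := (lawSubgroup n).map φ.rangeRestrict
  have : V.Normal := Subgroup.Normal.map inferInstance _ φ.rangeRestrict_surjective
  refine .of_extension _ V ?_ ?_
  · refine .of_forall_mem (φ.range.subtype.comp V.subtype)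
      (Subtype.val_injective.comp Subtype.val_injective) ?_ h
    rintro ⟨_, w, hw, rfl⟩
    exact ⟨w, hw, rfl⟩
  · let g : FreeGroup ℕ →* φ.range ⧸ V := (QuotientGroup.mk' V).comp φ.rangeRestrict
    have hg : D.ker ≤ g.ker := by
      intro w hw
      obtain ⟨v, hv, hvw⟩ := hker w hw
      rw [MonoidHom.mem_ker, MonoidHom.comp_apply, QuotientGroup.mk'_apply,
        QuotientGroup.eq_one_iff]
      exact ⟨v, hv, Subtype.ext hvw⟩
    refine .of_surjective (FreeGroup ℕ ⧸ D.ker) _ (QuotientGroup.lift D.ker g hg) ?_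
      (.of_injective _ _ (QuotientGroup.kerLift D) (QuotientGroup.kerLift_injective D) hDr)
    refine QuotientGroup.lift_surjective_of_surjective _ _ ?_ _
    exact (QuotientGroup.mk'_surjective V).comp φ.rangeRestrict_surjective

/-- A witness that a group is not elementary amenable: a descending sequence of nontrivial finitely
generated subgroups, each in the verbal subgroup of its predecessor for the words in `lawSubgroup n`. -/
structure IsLawDescent {G : Type} [Group G] (l : ℕ → List (FreeGroup ℕ))
    (φ : ℕ → FreeGroup ℕ →* G) : Prop where
  finitary : IsFinitary (φ 0)
  succ : ∀ n, φ (n + 1) = (φ n).comp (evalList (l n))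
  law : ∀ n, ∀ w ∈ l n, w ∈ lawSubgroup n
  ne_one : ∀ n, φ n ≠ 1

theorem IsLawDescent.finitary_all {G : Type} [Group G] {l : ℕ → List (FreeGroup ℕ)}
    {φ : ℕ → FreeGroup ℕ →* G} (h : IsLawDescent l φ) : ∀ n, IsFinitary (φ n)
  | 0 => h.finitary
  | n + 1 => by
    rw [h.succ]
    exact (isFinitary_evalList _).comp _

theorem IsLawDescent.apply_mem {G : Type} [Group G] {l : ℕ → List (FreeGroup ℕ)}
    {φ : ℕ → FreeGroup ℕ →* G} (h : IsLawDescent l φ) (n : ℕ) (w : FreeGroup ℕ) :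
    evalList (l n) w ∈ lawSubgroup n :=
  range_evalList_le (h.law n) ⟨w, rfl⟩

/-- A descent whose `n`th term lies in a subgroup gives a descent in the subgroup. -/
theorem IsLawDescent.restrict {G : Type} [Group G] {l : ℕ → List (FreeGroup ℕ)}
    {φ : ℕ → FreeGroup ℕ →* G} (h : IsLawDescent l φ) (n : ℕ) (H : Subgroup G)
    (hH : ∀ w, φ n w ∈ H) :
    ∃ (l' : ℕ → List (FreeGroup ℕ)) (φ' : ℕ → FreeGroup ℕ →* H), IsLawDescent l' φ' := by
  have hmem : ∀ i w, φ (n + i) w ∈ H := by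
    intro i
    induction i with
    | zero => exact hH
    | succ i ih =>
      intro w
      rw [← add_assoc, h.succ]
      exact ih _
  refine ⟨fun i => l (n + i), fun i => (φ (n + i)).codRestrict H (hmem i), ?_, ?_, ?_, ?_⟩
  · obtain ⟨k, hk⟩ := h.finitary_all n
    exact ⟨k, fun i hi => Subtype.ext (hk i hi)⟩
  · intro i
    ext j
    exact DFunLike.congr_fun (h.succ (n + i)) (FreeGroup.of j)
  · exact fun i w hw => lawSubgroup_antitone (Nat.le_add_left i n) (h.law (n + i) w hw)
  · intro i hi
    refine h.ne_one (n + i) (MonoidHom.ext fun w => ?_)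
    exact congrArg Subtype.val (DFunLike.congr_fun hi w)

/-- In an extension, either the descent stays nontrivial in the quotient or it enters `N`. A union
absorbs its finitely generated first term at some stage. Through a surjection, the finitely many
initial generators lift and the same words apply. -/
theorem IsElementaryAmenable.not_isLawDescent {G : Type} [Group G] (hG : IsElementaryAmenable G) :
    ∀ (l : ℕ → List (FreeGroup ℕ)) (φ : ℕ → FreeGroup ℕ →* G), ¬ IsLawDescent l φ := by
  induction hG with
  | of_finite G =>
    intro l φ h
    refine h.ne_one (Nat.card G + 1) (MonoidHom.ext fun w => ?_)
    rw [h.succ, MonoidHom.comp_apply, MonoidHom.one_apply]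
    have hw := (mem_lawSubgroup.1 (h.apply_mem (Nat.card G) w)).2 _ le_rfl
      (((Finite.equivFin G).permCongrHom.toMonoidHom.comp (MulAction.toPermHom G G)).comp
        (φ (Nat.card G)))
    have hinj : Function.Injective ((Finite.equivFin G).permCongrHom.toMonoidHom.comp
        (MulAction.toPermHom G G)) :=
      (Finite.equivFin G).permCongrHom.injective.comp MulAction.toPerm_injective
    rw [MonoidHom.comp_apply] at hw
    exact hinj (hw.trans (map_one _).symm)
  | of_abelian G hcomm =>
    intro l φ h
    refine h.ne_one 1 (MonoidHom.ext fun w => ?_)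
    rw [h.succ, MonoidHom.comp_apply, MonoidHom.one_apply]
    have hw := (mem_lawSubgroup.1 (h.apply_mem 0 w)).1
    let _ : CommGroup G := { mul_comm := hcomm }
    exact MonoidHom.mem_ker.1 (Abelianization.commutator_subset_ker (φ 0) hw)
  | of_extension G N hN hQ ihN ihQ =>
    intro l φ h
    have hex : ∃ n, (QuotientGroup.mk' N).comp (φ n) = 1 := by
      by_contra! hne
      refine ihQ l (fun n => (QuotientGroup.mk' N).comp (φ n)) ⟨h.finitary.comp _, ?_, h.law, hne⟩
      intro n
      rw [h.succ, MonoidHom.comp_assoc]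
    obtain ⟨n, hn⟩ := hex
    obtain ⟨l', φ', h'⟩ := h.restrict n N fun w =>
      (QuotientGroup.eq_one_iff _).1 (DFunLike.congr_fun hn w)
    exact ihN l' φ' h'
  | of_iUnion G H hmono hunion hH ih =>
    intro l φ h
    obtain ⟨k, hk⟩ := h.finitary
    choose f hf using fun i => hunion (φ 0 (FreeGroup.of i))
    let n := (Finset.range k).sup f
    have hgen : (φ 0).range ≤ H n := by
      rw [MonoidHom.range_eq_map, ← FreeGroup.closure_range_of, MonoidHom.map_closure,
        Subgroup.closure_le]
      rintro _ ⟨_, ⟨i, rfl⟩, rfl⟩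
      rw [SetLike.mem_coe]
      by_cases hi : i < k
      · exact hmono (Finset.le_sup (f := f) (Finset.mem_range.2 hi)) (hf i)
      · rw [hk i (not_lt.1 hi)]
        exact (H n).one_mem
    obtain ⟨l', φ', h'⟩ := h.restrict 0 (H n) fun w => hgen ⟨w, rfl⟩
    exact ih n l' φ' h'
  | of_injective G H f hf hG ih =>
    intro l φ h
    refine ih l (fun n => f.comp (φ n)) ⟨h.finitary.comp _, ?_, h.law, ?_⟩
    · intro n
      rw [h.succ, MonoidHom.comp_assoc]
    · intro n hn
      refine h.ne_one n (MonoidHom.ext fun w => hf ?_)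
      simpa using DFunLike.congr_fun hn w
  | of_surjective G Q f hf hG ih =>
    intro l φ h
    obtain ⟨k, hk⟩ := h.finitary
    choose s hs using hf
    let ψ : ℕ → FreeGroup ℕ →* G := fun n => Nat.rec
      (FreeGroup.lift fun i => if i < k then s (φ 0 (FreeGroup.of i)) else 1)
      (fun n ψ => ψ.comp (evalList (l n))) n
    have hψ : ∀ n, f.comp (ψ n) = φ n := by
      intro n
      induction n with
      | zero =>
        ext i
        by_cases hi : i < k
        · simp [ψ, hi, hs]
        · simp [ψ, hi, hk i (not_lt.1 hi)]
      | succ n ihn =>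
        rw [h.succ, ← ihn, MonoidHom.comp_assoc]
    refine ih l ψ ⟨⟨k, fun i hi => ?_⟩, fun n => rfl, h.law, fun n hn => h.ne_one n ?_⟩
    · simp [ψ, not_lt.2 hi]
    · rw [← hψ, hn, MonoidHom.comp_one]

/-- One step of a descent through subgroups that are not elementary amenable. -/
theorem exists_list_not_isElementaryAmenable {G : Type} [Group G] {φ : FreeGroup ℕ →* G}
    (hφ : IsFinitary φ) (hne : ¬ IsElementaryAmenable φ.range) (n : ℕ) :
    ∃ l : List (FreeGroup ℕ), (∀ w ∈ l, w ∈ lawSubgroup n) ∧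
      ¬ IsElementaryAmenable (φ.comp (evalList l)).range := by
  by_contra! hcon
  refine hne (.of_map_lawSubgroup hφ n ?_)
  have : Countable ((lawSubgroup n).map φ) :=
    (show Function.Surjective (φ.subgroupMap (lawSubgroup n)) from
      φ.subgroupMap_surjective _).countable
  refine .of_locally fun l => ?_
  -- Generators of a subgroup of the image lift to words in `lawSubgroup n`; these form the list.
  choose s hs using fun x : (lawSubgroup n).map φ => x.2
  have h := hcon (l.map s) (by
    intro w hw
    obtain ⟨x, -, rfl⟩ := List.mem_map.1 hw
    exact (hs x).1)
  have hcomp : ((lawSubgroup n).map φ).subtype.comp (evalList l) = φ.comp (evalList (l.map s)) := by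
    ext i
    simp only [MonoidHom.comp_apply, evalList_of]
    by_cases hi : i < l.length
    · rw [List.getD_eq_getElem _ _ hi, List.getD_eq_getElem _ _ (by simpa using hi)]
      simp [(hs _).2]
    · rw [List.getD_eq_default _ _ (not_lt.1 hi), List.getD_eq_default _ _ (by simpa using hi)]
      simp
  rw [← hcomp] at h
  refine .of_forall_mem (((lawSubgroup n).map φ).subtype.comp (Subgroup.subtype _))
    (Subtype.val_injective.comp Subtype.val_injective) ?_ h
  rintro ⟨_, w, rfl⟩
  exact ⟨w, rfl⟩

theorem exists_isLawDescent {G : Type} [Group G] [Countable G] (hG : ¬ IsElementaryAmenable G) :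
    ∃ (l : ℕ → List (FreeGroup ℕ)) (φ : ℕ → FreeGroup ℕ →* G), IsLawDescent l φ := by
  have h0 : ∃ l : List G, ¬ IsElementaryAmenable (evalList l).range := by
    by_contra! h
    exact hG (.of_locally h)
  obtain ⟨l0, h0⟩ := h0
  let S := {φ : FreeGroup ℕ →* G // IsFinitary φ ∧ ¬ IsElementaryAmenable φ.range}
  choose nxt hlaw hnot using fun (φ : S) (n : ℕ) =>
    exists_list_not_isElementaryAmenable φ.2.1 φ.2.2 n
  let φ : ℕ → S := fun n => Nat.rec ⟨evalList l0, isFinitary_evalList l0, h0⟩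
    (fun n φ => ⟨φ.1.comp (evalList (nxt φ n)), (isFinitary_evalList _).comp _, hnot φ n⟩) n
  refine ⟨fun n => nxt (φ n) n, fun n => (φ n).1, (φ 0).2.1, fun n => rfl,
    fun n => hlaw (φ n) n, fun n hn => (φ n).2.2 ?_⟩
  rw [hn, MonoidHom.range_one]
  exact .of_finite _

/-! ### The groups of nodes, acting on words -/

open scoped commutatorElement

/-- The commutator with a power that vanishes in the symmetric groups of degree at most `k` is a
law in these groups. -/
theorem commutator_pow_mem_lawSubgroup (k m : ℕ) (hm : k ≤ m) (g h : FreeGroup ℕ) :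
    ⁅g, h ^ m.factorial⁆ ∈ lawSubgroup k := by
  refine mem_lawSubgroup.2 ⟨Subgroup.commutator_mem_commutator (Subgroup.mem_top _)
    (Subgroup.mem_top _), fun j hj ψ => ?_⟩
  have : ψ h ^ m.factorial = 1 := by
    obtain ⟨c, hc⟩ := Nat.factorial_dvd_factorial (hj.trans hm)
    rw [hc, pow_mul]
    have : ψ h ^ j.factorial = 1 := by
      have := pow_card_eq_one' (x := ψ h)
      rwa [Nat.card_perm, Nat.card_fin] at this
    rw [this, one_pow]
  rw [map_commutatorElement, map_pow, this, commutatorElement_one_right]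

/-- The action on words of a family of permutations indexed by the first letter. -/
def baseAction : (ℤ × ℕ → Equiv.Perm (List (ℤ × ℕ))) →* Equiv.Perm (List (ℤ × ℕ)) where
  toFun c :=
    { toFun := fun v => match v with
        | [] => []
        | a :: v => a :: c a v
      invFun := fun v => match v with
        | [] => []
        | a :: v => a :: (c a).symm v
      left_inv := by rintro (_ | ⟨a, v⟩) <;> simp
      right_inv := by rintro (_ | ⟨a, v⟩) <;> simp }
  map_one' := by ext1 v; rcases v with _ | ⟨a, v⟩ <;> rfl
  map_mul' c d := by ext1 v; rcases v with _ | ⟨a, v⟩ <;> rfl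

@[simp] theorem baseAction_cons (c : ℤ × ℕ → Equiv.Perm (List (ℤ × ℕ))) (a : ℤ × ℕ)
    (v : List (ℤ × ℕ)) : baseAction c (a :: v) = a :: c a v := rfl

/-- The translation of the first letter of a word. -/
def shiftFun (k : ℤ) : List (ℤ × ℕ) → List (ℤ × ℕ)
  | [] => []
  | a :: v => (a.1 + k, a.2) :: v

/-- The translations of the first letter, as permutations. -/
def shiftAction : Multiplicative ℤ →* Equiv.Perm (List (ℤ × ℕ)) where
  toFun k :=
    { toFun := shiftFun k.toAdd
      invFun := shiftFun (-k.toAdd)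
      left_inv := by rintro (_ | ⟨a, v⟩) <;> simp [shiftFun]
      right_inv := by rintro (_ | ⟨a, v⟩) <;> simp [shiftFun] }
  map_one' := by ext1 v; rcases v with _ | ⟨a, v⟩ <;> simp [shiftFun]
  map_mul' k l := by
    ext1 v
    rcases v with _ | ⟨a, v⟩
    · rfl
    · simp [shiftFun, add_assoc, add_comm l.toAdd]

@[simp] theorem shiftAction_cons (k : Multiplicative ℤ) (a : ℤ × ℕ) (v : List (ℤ × ℕ)) :
    shiftAction k (a :: v) = (a.1 + k.toAdd, a.2) :: v := rfl

/-- The generator of the translations. -/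
def shiftGen : Equiv.Perm (List (ℤ × ℕ)) := shiftAction (Multiplicative.ofAdd 1)

open Classical in
/-- The action of the base generator attached to a node `s` of a set of nodes `T`. -/
noncomputable def treeFun (T : Set (List ℕ)) : List ℕ → List (ℤ × ℕ) → List (ℤ × ℕ)
  | _, [] => []
  | s, a :: v => a :: if s ++ [a.2] ∈ T then
      if a.1 = 0 then treeFun T (s ++ [a.2]) v else if a.1 = a.2 + 1 then shiftGen v else v
    else v

open Classical in
/-- The inverse of `treeFun`. -/
noncomputable def treeInv (T : Set (List ℕ)) : List ℕ → List (ℤ × ℕ) → List (ℤ × ℕ)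
  | _, [] => []
  | s, a :: v => a :: if s ++ [a.2] ∈ T then
      if a.1 = 0 then treeInv T (s ++ [a.2]) v else if a.1 = a.2 + 1 then shiftGen.symm v else v
    else v

theorem treeInv_treeFun (T : Set (List ℕ)) : ∀ s v, treeInv T s (treeFun T s v) = v
  | _, [] => rfl
  | s, a :: v => by
    rw [treeFun, treeInv]
    split_ifs <;> simp [treeInv_treeFun T]

theorem treeFun_treeInv (T : Set (List ℕ)) : ∀ s v, treeFun T s (treeInv T s v) = v
  | _, [] => rfl
  | s, a :: v => by
    rw [treeInv, treeFun]
    split_ifs <;> simp [treeFun_treeInv T]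

/-- The base generator attached to a node `s` of a set of nodes `T`, as a permutation. -/
noncomputable def treePerm (T : Set (List ℕ)) (s : List ℕ) : Equiv.Perm (List (ℤ × ℕ)) :=
  ⟨treeFun T s, treeInv T s, treeInv_treeFun T s, treeFun_treeInv T s⟩

open Classical in
/-- The sections of the base generator at the letters. -/
noncomputable def treeSection (T : Set (List ℕ)) (s : List ℕ) (a : ℤ × ℕ) :
    Equiv.Perm (List (ℤ × ℕ)) :=
  if s ++ [a.2] ∈ T then
    if a.1 = 0 then treePerm T (s ++ [a.2]) else if a.1 = a.2 + 1 then shiftGen else 1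
  else 1

theorem baseAction_treeSection (T : Set (List ℕ)) (s : List ℕ) :
    baseAction (treeSection T s) = treePerm T s := by
  ext1 v
  rcases v with _ | ⟨a, v⟩
  · rfl
  · rw [baseAction_cons, treeSection]
    change _ = treeFun T s (a :: v)
    rw [treeFun]
    split_ifs <;> rfl

/-- The homomorphism from the free group onto the group of a node: the first letter goes to the
base generator, the second to the translation, the others to `1`. -/
noncomputable def nodeHom (T : Set (List ℕ)) (s : List ℕ) :
    FreeGroup ℕ →* Equiv.Perm (List (ℤ × ℕ)) :=
  evalList [treePerm T s, shiftGen]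

theorem shiftGen_zpow (k : ℤ) : shiftGen ^ k = shiftAction (Multiplicative.ofAdd k) := by
  rw [shiftGen, ← map_zpow, ← ofAdd_zsmul]
  simp

/-- The translates of a family of permutations. -/
theorem shiftAction_conj (k : Multiplicative ℤ) (c : ℤ × ℕ → Equiv.Perm (List (ℤ × ℕ))) :
    shiftAction k * baseAction c * (shiftAction k)⁻¹ =
      baseAction fun a => c (a.1 - k.toAdd, a.2) := by
  rw [← map_inv]
  ext1 v
  rcases v with _ | ⟨a, v⟩
  · rfl
  · rw [Equiv.Perm.mul_apply, Equiv.Perm.mul_apply, shiftAction_cons, baseAction_cons,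
      shiftAction_cons]
    simp [sub_eq_add_neg]

/-- The commutators of translates of the base generator with a large power of the translation have
the sections of the base generator. -/
theorem nodeHom_commutator_apply (T : Set (List ℕ)) (s : List ℕ) (n M : ℕ) (k : ℤ) (hM : n + 1 < M)
    (hk : k = 0 ∨ k = n + 1) (v : List (ℤ × ℕ)) :
    nodeHom T s ⁅FreeGroup.of 1 ^ (-k) * FreeGroup.of 0 * (FreeGroup.of 1 ^ (-k))⁻¹,
      FreeGroup.of 1 ^ M⁆ ((0, n) :: v) = (0, n) :: treeSection T s (k, n) v := by
  have h0 : nodeHom T s (FreeGroup.of 0) = baseAction (treeSection T s) := by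
    rw [nodeHom, evalList_of, baseAction_treeSection]
    rfl
  have h1 : nodeHom T s (FreeGroup.of 1) = shiftGen := by
    rw [nodeHom, evalList_of]
    rfl
  have hcomm : ∀ g h : FreeGroup ℕ, ⁅g, h⁆ = g * (h * g⁻¹ * h⁻¹) := fun g h => by
    simp [commutatorElement_def, mul_assoc]
  rw [hcomm]
  simp only [map_mul, map_inv, map_zpow, map_pow, h0, h1]
  rw [← zpow_natCast, shiftGen_zpow, shiftGen_zpow, shiftAction_conj, ← map_inv baseAction,
    shiftAction_conj, ← map_mul, baseAction_cons]
  -- The second factor of the commutator is an inverse translate; `M > n + 1` makes its offset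
  -- negative, where the base generator has trivial section.
  have htriv : treeSection T s (k - M, n) = 1 := by
    have h2 : k - M ≠ 0 := by omega
    have h3 : k - M ≠ n + 1 := by omega
    simp [treeSection, h2, h3]
  have htriv' : treeSection T s (-M + k, n) = 1 := by rwa [neg_add_eq_sub]
  simp [htriv']

/-- The list of words that carries a node to its `n`th child. -/
def childWords (k n : ℕ) : List (FreeGroup ℕ) :=
  [⁅FreeGroup.of 1 ^ (-(0 : ℤ)) * FreeGroup.of 0 * (FreeGroup.of 1 ^ (-(0 : ℤ)))⁻¹,
      FreeGroup.of 1 ^ (k + n + 2).factorial⁆,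
    ⁅FreeGroup.of 1 ^ (-(n + 1 : ℤ)) * FreeGroup.of 0 * (FreeGroup.of 1 ^ (-(n + 1 : ℤ)))⁻¹,
      FreeGroup.of 1 ^ (k + n + 2).factorial⁆]

theorem childWords_mem {k n : ℕ} {w : FreeGroup ℕ} (hw : w ∈ childWords k n) :
    w ∈ lawSubgroup k := by
  rw [childWords, List.mem_cons, List.mem_singleton] at hw
  rcases hw with rfl | rfl <;> exact commutator_pow_mem_lawSubgroup k _ (by omega) _ _

theorem nodeHom_childWords (T : Set (List ℕ)) (s : List ℕ) (k n : ℕ) (hs : s ++ [n] ∈ T)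
    (w : FreeGroup ℕ) (v : List (ℤ × ℕ)) :
    nodeHom T s (evalList (childWords k n) w) ((0, n) :: v) =
      (0, n) :: nodeHom T (s ++ [n]) w v := by
  -- The summand `n + 2` in the exponent serves this bound; the summand `k` makes the words laws in
  -- degree at most `k`.
  have hM : n + 1 < (k + n + 2).factorial :=
    lt_of_lt_of_le (by omega) (Nat.self_le_factorial _)
  have hn : (n : ℤ) + 1 ≠ 0 := by omega
  have hgen : ∀ i v, nodeHom T s (evalList (childWords k n) (FreeGroup.of i)) ((0, n) :: v) =
      (0, n) :: nodeHom T (s ++ [n]) (FreeGroup.of i) v := by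
    intro i v
    rw [evalList_of, nodeHom.eq_def T (s ++ [n]), evalList_of]
    rcases i with _ | _ | i
    · refine (nodeHom_commutator_apply T s n _ 0 hM (Or.inl rfl) v).trans ?_
      simp [treeSection, hs]
    · refine (nodeHom_commutator_apply T s n _ (n + 1) hM (Or.inr rfl) v).trans ?_
      simp [treeSection, hs, hn]
    · change nodeHom T s 1 _ = (0, n) :: v
      simp
  induction w using FreeGroup.induction_on generalizing v with
  | C1 => simp
  | of i => exact hgen i v
  | inv_of i hi =>
    rw [map_inv, map_inv, map_inv, Equiv.Perm.inv_eq_iff_eq, hgen, ← Equiv.Perm.mul_apply,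
      mul_inv_cancel, Equiv.Perm.one_apply]
  | mul x y hx hy => rw [map_mul, map_mul, map_mul, Equiv.Perm.mul_apply, hy, hx,
      Equiv.Perm.mul_apply]

/-! ### A branch gives a descent -/

/-- A set of nodes has an infinite branch if it contains all nonempty initial segments of some
sequence. -/
def HasBranch (T : Set (List ℕ)) : Prop :=
  ∃ y : ℕ → ℕ, ∀ n, (List.range (n + 1)).map y ∈ T

/-- After the prefix `(0, y 0), …, (0, y (n - 1))`, term `n` of the descent acts as the group of the
branch node of length `n`, which contains the nontrivial translation. -/
theorem not_isElementaryAmenable_of_hasBranch {T : Set (List ℕ)} (hT : HasBranch T) :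
    ¬ IsElementaryAmenable (nodeHom T []).range := by
  obtain ⟨y, hy⟩ := hT
  intro hEA
  let l : ℕ → List (FreeGroup ℕ) := fun n => childWords n (y n)
  let E : ℕ → FreeGroup ℕ →* FreeGroup ℕ := fun n =>
    Nat.rec (MonoidHom.id _) (fun n f => f.comp (evalList (l n))) n
  have hE : ∀ n w v, nodeHom T [] (E n w) ((List.range n).map (fun i => ((0 : ℤ), y i)) ++ v) =
      (List.range n).map (fun i => ((0 : ℤ), y i)) ++ nodeHom T ((List.range n).map y) w v := by
    intro n
    induction n with
    | zero => exact fun w v => rfl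
    | succ n ih =>
      intro w v
      have hy' := hy n
      rw [List.range_succ, List.map_append, List.map_singleton] at hy'
      change nodeHom T [] (E n (evalList (l n) w)) _ = _
      rw [List.range_succ, List.map_append, List.map_append, List.map_singleton,
        List.map_singleton, List.append_assoc, List.append_assoc, ih, List.singleton_append,
        nodeHom_childWords T _ n (y n) hy', List.singleton_append]
  refine hEA.not_isLawDescent l (fun n => (nodeHom T []).rangeRestrict.comp (E n))
    ⟨?_, fun n => rfl, fun n w hw => childWords_mem hw, fun n hn => ?_⟩
  · obtain ⟨k, hk⟩ := isFinitary_evalList [treePerm T [], shiftGen]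
    exact ⟨k, fun i hi => Subtype.ext (hk i hi)⟩
  · have h1 : nodeHom T [] (E n (FreeGroup.of 1)) = 1 :=
      congrArg Subtype.val (DFunLike.congr_fun hn (FreeGroup.of 1))
    have h2 := hE n (FreeGroup.of 1) [(0, 0)]
    rw [h1, Equiv.Perm.one_apply, List.append_cancel_left_eq, nodeHom, evalList_of] at h2
    change _ = shiftGen _ at h2
    simp [shiftGen] at h2

/-! ### Without a branch the group is elementary amenable -/

/-- The families with finite support. -/
def finiteSupportSubgroup (ι P : Type) [Group P] : Subgroup (ι → P) where
  carrier := {u | (Function.mulSupport u).Finite}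
  one_mem' := by simp [Function.mulSupport_one]
  mul_mem' ha hb := (ha.union hb).subset (Function.mulSupport_mul _ _)
  inv_mem' {u} ha := by
    change (Function.mulSupport u⁻¹).Finite
    rw [Function.mulSupport_inv]
    exact ha

theorem mem_finiteSupportSubgroup {ι P : Type} [Group P] {u : ι → P} :
    u ∈ finiteSupportSubgroup ι P ↔ (Function.mulSupport u).Finite := Iff.rfl

instance (ι P : Type) [Group P] : (finiteSupportSubgroup ι P).Normal := by
  refine ⟨fun u hu g => ?_⟩
  rw [mem_finiteSupportSubgroup] at hu ⊢
  refine hu.subset fun a ha hua => ha ?_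
  simp [hua]

namespace IsElementaryAmenable

/-- The group generated by countably many families that commute up to finite support and have
coordinates in elementary amenable groups is elementary amenable. -/
theorem range_lift_of_commute {κ ι P : Type} [Group P] [Countable κ] [Denumerable ι]
    (c : κ → ι → P) (K : ι → Subgroup P) (hK : ∀ a, IsElementaryAmenable (K a))
    (hc : ∀ k a, c k a ∈ K a) (hcomm : ∀ i j, {a | ¬ Commute (c i a) (c j a)}.Finite) :
    IsElementaryAmenable (FreeGroup.lift c).range := by
  let U := (FreeGroup.lift c).range
  have hUK : ∀ u ∈ U, ∀ a, u a ∈ K a := by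
    intro u hu a
    have h : U ≤ (K a).comap (Pi.evalMonoidHom (fun _ => P) a) := by
      change (FreeGroup.lift c).range ≤ _
      rw [FreeGroup.range_lift_eq_closure, Subgroup.closure_le]
      rintro _ ⟨k, rfl⟩
      exact hc k a
    exact h hu
  -- The image of `f` is abelian, and the coordinates separate the finitely supported elements of
  -- its kernel.
  let f : U →* (ι → P) ⧸ finiteSupportSubgroup ι P := (QuotientGroup.mk' _).comp U.subtype
  refine of_ker_range f ?_ ?_
  · let e := (Denumerable.eqv ι).symm
    have hker : ∀ x : f.ker, (Function.mulSupport ((x : U) : ι → P)).Finite := fun x =>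
      (QuotientGroup.eq_one_iff _).1 (MonoidHom.mem_ker.1 x.2)
    refine of_finite_support (fun i => ((Pi.evalMonoidHom (fun _ => P) (e i)).comp
      U.subtype).comp (Subgroup.subtype _)) (fun i => mono ?_ (hK (e i))) ?_ ?_
    · rintro _ ⟨x, rfl⟩
      exact hUK _ (x : U).2 _
    · intro x hx
      refine Subtype.ext (Subtype.ext (funext fun a => ?_))
      have := hx (e.symm a)
      simpa using this
    · intro x
      have hfin := (hker x).preimage (f := e) e.injective.injOn
      obtain ⟨n, hn⟩ := hfin.bddAbove
      refine ⟨n + 1, fun i hi => ?_⟩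
      by_contra hne
      exact absurd (hn (show i ∈ e ⁻¹' _ from hne)) (by omega)
  · have : Countable U := (FreeGroup.lift c).rangeRestrict_surjective.countable
    have : Countable f.range := f.rangeRestrict_surjective.countable
    have hfr : f.range = Subgroup.closure
        (Set.range fun k => QuotientGroup.mk' (finiteSupportSubgroup ι P) (c k)) := by
      rw [MonoidHom.range_comp, Subgroup.range_subtype]
      change (FreeGroup.lift c).range.map _ = _
      rw [FreeGroup.range_lift_eq_closure, MonoidHom.map_closure, ← Set.range_comp]
      rfl
    refine of_abelian _ ?_
    rw [hfr]
    have := Subgroup.isMulCommutative_closure (k := Set.range fun k =>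
      QuotientGroup.mk' (finiteSupportSubgroup ι P) (c k)) (by
        rintro _ ⟨i, rfl⟩ _ ⟨j, rfl⟩
        rw [← map_mul, ← map_mul]
        refine QuotientGroup.eq.2 ((hcomm i j).subset fun a ha hij => ha ?_)
        change (c i a * c j a)⁻¹ * (c j a * c i a) = 1
        rw [hij.eq, inv_mul_cancel])
    exact fun a b => mul_comm' a b

end IsElementaryAmenable

/-- The translation of the first coordinate on families. -/
def shiftAut (P : Type) [Group P] : Multiplicative ℤ →* MulAut (ℤ × ℕ → P) where
  toFun k :=
    { toFun := fun c a => c (a.1 - k.toAdd, a.2)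
      invFun := fun c a => c (a.1 + k.toAdd, a.2)
      left_inv := fun c => by ext; simp
      right_inv := fun c => by ext; simp
      map_mul' := fun c d => rfl }
  map_one' := by ext; simp
  map_mul' k l := by
    ext c a
    simp [sub_sub]

/-- The kernel of the projection to `ℤ` lies in the group generated by the translates of `c`, to
which `range_lift_of_commute` applies. -/
theorem IsElementaryAmenable.range_shift_semidirect {P : Type} [Group P] (c : ℤ × ℕ → P)
    (K : ℕ → Subgroup P) (hK : ∀ n, IsElementaryAmenable (K n)) (hc : ∀ a, c a ∈ K a.2)
    (hcomm : ∀ i j : ℤ, {a : ℤ × ℕ | ¬ Commute (c (a.1 - i, a.2)) (c (a.1 - j, a.2))}.Finite) :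
    IsElementaryAmenable (evalList [(SemidirectProduct.inl c : (ℤ × ℕ → P) ⋊[shiftAut P]
      Multiplicative ℤ), SemidirectProduct.inr (Multiplicative.ofAdd 1)]).range := by
  set ψ := evalList [(SemidirectProduct.inl c : (ℤ × ℕ → P) ⋊[shiftAut P] Multiplicative ℤ),
    SemidirectProduct.inr (Multiplicative.ofAdd 1)] with hψ
  let U := (FreeGroup.lift fun k : Multiplicative ℤ => shiftAut P k c).range
  have hU : IsElementaryAmenable U :=
    .range_lift_of_commute _ (fun a => K a.2) (fun a => hK a.2) (fun k a => hc (a.1 - k.toAdd, a.2))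
      fun i j => hcomm i.toAdd j.toAdd
  have hinv : ∀ k, ∀ u ∈ U, shiftAut P k u ∈ U := by
    intro k u hu
    have h : U ≤ U.comap (shiftAut P k).toMonoidHom := by
      change (FreeGroup.lift _).range ≤ _
      rw [FreeGroup.range_lift_eq_closure, Subgroup.closure_le]
      rintro _ ⟨l, rfl⟩
      refine ⟨FreeGroup.of (k * l), ?_⟩
      rw [FreeGroup.lift_apply_of, map_mul]
      rfl
    exact h hu
  have hleft : ∀ w, (ψ w).left ∈ U := by
    intro w
    have hgen : ∀ i, (ψ (FreeGroup.of i)).left ∈ U := by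
      intro i
      rw [hψ, evalList_of]
      rcases i with _ | _ | i
      · refine ⟨FreeGroup.of 1, ?_⟩
        rw [FreeGroup.lift_apply_of, map_one]
        rfl
      · exact U.one_mem
      · exact U.one_mem
    induction w using FreeGroup.induction_on with
    | C1 => rw [map_one]; exact U.one_mem
    | of i => exact hgen i
    | inv_of i hi =>
      rw [map_inv, SemidirectProduct.inv_left]
      exact hinv _ _ (U.inv_mem hi)
    | mul x y hx hy =>
      rw [map_mul, SemidirectProduct.mul_left]
      exact U.mul_mem hx (hinv _ _ hy)
  refine .of_ker_range (SemidirectProduct.rightHom.comp ψ.range.subtype) ?_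
    (.of_injective _ _ (Subgroup.subtype _) (Subgroup.subtype_injective _)
      (.of_abelian (Multiplicative ℤ) mul_comm))
  have hUinl : IsElementaryAmenable (U.map (SemidirectProduct.inl (φ := shiftAut P))) :=
    .of_surjective U _ (SemidirectProduct.inl.subgroupMap U)
      (MonoidHom.subgroupMap_surjective _ _) hU
  refine .of_forall_mem (ψ.range.subtype.comp (Subgroup.subtype _))
    (Subtype.val_injective.comp Subtype.val_injective) ?_ hUinl
  rintro ⟨⟨_, w, rfl⟩, hw⟩
  refine ⟨(ψ w).left, hleft w, ?_⟩
  refine SemidirectProduct.ext rfl ?_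
  exact (MonoidHom.mem_ker.1 hw).symm

theorem nodeHom_isElementaryAmenable_step (T : Set (List ℕ)) (s : List ℕ)
    (h : ∀ n, s ++ [n] ∈ T → IsElementaryAmenable (nodeHom T (s ++ [n])).range) :
    IsElementaryAmenable (nodeHom T s).range := by
  classical
  let L : (ℤ × ℕ → Equiv.Perm (List (ℤ × ℕ))) ⋊[shiftAut _] Multiplicative ℤ →*
      Equiv.Perm (List (ℤ × ℕ)) := SemidirectProduct.lift baseAction shiftAction (by
    intro k
    ext1 c
    exact (shiftAction_conj k c).symm)
  have hEA := IsElementaryAmenable.range_shift_semidirect (treeSection T s)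
    (fun n => if s ++ [n] ∈ T then (nodeHom T (s ++ [n])).range else ⊥) (by
      intro n
      by_cases hn : s ++ [n] ∈ T
      · rw [if_pos hn]
        exact h n hn
      · rw [if_neg hn]
        exact .of_finite _) (by
      intro a
      rw [treeSection]
      split_ifs
      · exact mem_range_evalList (by simp)
      · exact mem_range_evalList (by simp)
      · exact Subgroup.one_mem _
      · exact Subgroup.one_mem _) (by
      intro i j
      -- Noncommuting translates need `z - i` and `z - j` to be `0` and `n + 1` in some order, so `n
      -- + 1 = |i - j|`. This is why the second offset varies with `n`.
      refine (((Set.finite_singleton i).insert j).prod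
        (Set.finite_singleton ((i - j).natAbs - 1))).subset ?_
      rintro ⟨z, n⟩ hzn
      have hij : i ≠ j := fun hij => hzn (by subst hij; exact Commute.refl _)
      have hsec : ∀ y : ℤ, treeSection T s (y, n) ≠ 1 → y = 0 ∨ y = n + 1 := by
        intro y hy
        by_contra! hcon
        exact hy (by simp [treeSection, hcon.1, hcon.2])
      have h1 := hsec (z - i) fun h1 => hzn (by simp only [h1]; exact Commute.one_left _)
      have h2 := hsec (z - j) fun h2 => hzn (by simp only [h2]; exact Commute.one_right _)
      rw [Set.mem_prod, Set.mem_insert_iff, Set.mem_singleton_iff, Set.mem_singleton_iff]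
      dsimp only
      omega)
  set ψ := evalList [(SemidirectProduct.inl (treeSection T s) :
    (ℤ × ℕ → Equiv.Perm (List (ℤ × ℕ))) ⋊[shiftAut _] Multiplicative ℤ),
    SemidirectProduct.inr (Multiplicative.ofAdd 1)] with hψ
  have hcomp : L.comp ψ = nodeHom T s := by
    ext1 i
    rw [MonoidHom.comp_apply, hψ, nodeHom, evalList_of, evalList_of]
    rcases i with _ | _ | i
    · exact (SemidirectProduct.lift_inl _ _ _ _).trans (baseAction_treeSection T s)
    · exact SemidirectProduct.lift_inr _ _ _ _
    · exact map_one L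
  rw [← hcomp, MonoidHom.range_comp]
  exact .of_surjective _ _ (L.subgroupMap _) (MonoidHom.subgroupMap_surjective _ _) hEA

/-- If the root were inaccessible for the child relation in `T`, choosing inaccessible children
would build a branch; so induction from the children applies. -/
theorem isElementaryAmenable_of_not_hasBranch {T : Set (List ℕ)} (hT : ¬ HasBranch T) :
    IsElementaryAmenable (nodeHom T []).range := by
  let r : List ℕ → List ℕ → Prop := fun b a => ∃ n, b = a ++ [n] ∧ b ∈ T
  have hacc : Acc r [] := by
    by_contra hnot
    refine hT ?_
    choose nxt hnxt hr using fun s : {s // ¬ Acc r s} => exists_not_acc_lt_of_not_acc s.2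
    choose y hy hyT using hr
    let σ : ℕ → {s // ¬ Acc r s} := fun n => Nat.rec ⟨[], hnot⟩ (fun _ s => ⟨nxt s, hnxt s⟩) n
    have hσ : ∀ n, (List.range n).map (fun i => y (σ i)) = (σ n).1 := by
      intro n
      induction n with
      | zero => rfl
      | succ n ih =>
        rw [List.range_succ, List.map_append, ih]
        exact (hy (σ n)).symm
    refine ⟨fun i => y (σ i), fun n => ?_⟩
    rw [hσ]
    exact hyT (σ n)
  generalize [] = s at hacc
  induction hacc with
  | intro s _ ih => exact nodeHom_isElementaryAmenable_step T s fun n hn => ih _ ⟨n, rfl, hn⟩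

theorem isElementaryAmenable_nodeHom_iff {T : Set (List ℕ)} :
    IsElementaryAmenable (nodeHom T []).range ↔ ¬ HasBranch T :=
  ⟨fun h hT => not_isElementaryAmenable_of_hasBranch hT h, isElementaryAmenable_of_not_hasBranch⟩

/-! ### Co-analyticity -/

theorem IsElementaryAmenable.carrier_iff_range {G : MarkedGroup} {H : Type} [Group H]
    {f : FreeGroup ℕ →* H} (hf : G.ker = f.ker) :
    IsElementaryAmenable G.Carrier ↔ IsElementaryAmenable f.range := by
  have e : G.Carrier ≃* f.range :=
    (QuotientGroup.quotientMulEquivOfEq hf).trans (QuotientGroup.quotientKerEquivRange f)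
  exact ⟨.of_mulEquiv e, .of_mulEquiv e.symm⟩

theorem MarkedGroup.measurableSet_mem_ker (w : FreeGroup ℕ) :
    MeasurableSet {G : MarkedGroup | w ∈ G.ker} := by
  have h : {G : MarkedGroup | w ∈ G.ker} = {G | toCantor G w = true} := by
    ext G
    simp [toCantor]
  rw [h]
  exact ((isClosed_discrete {true}).preimage
    ((continuous_apply w).comp isClosedEmbedding_toCantor.continuous)).measurableSet

theorem MarkedGroup.measurable_of_mem_ker {α : Type} [MeasurableSpace α] {f : α → MarkedGroup}
    (hf : ∀ w, MeasurableSet {a | w ∈ (f a).ker}) : Measurable f := by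
  have : BorelSpace (FreeGroup ℕ → Bool) := Pi.borelSpace
  refine isClosedEmbedding_toCantor.measurableEmbedding.measurable_comp_iff.1 ?_
  refine measurable_pi_iff.2 fun w => measurable_to_bool ?_
  convert hf w using 1
  ext a
  simp [toCantor]

/-- The composite of the first `n + 1` substitutions in a sequence. -/
def compEval (l : ℕ → List (FreeGroup ℕ)) (n : ℕ) : FreeGroup ℕ →* FreeGroup ℕ :=
  Nat.rec (evalList (l 0)) (fun n f => f.comp (evalList (l (n + 1)))) n

/-- Entry `0` of `l` lifts the initial generators of a descent, hence the index shift. The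
quantifier now ranges over words alone, independently of `G`, as a projection requires. -/
theorem not_isElementaryAmenable_iff (G : MarkedGroup) : ¬ IsElementaryAmenable G.Carrier ↔
    ∃ l : ℕ → List (FreeGroup ℕ), (∀ n, ∀ w ∈ l (n + 1), w ∈ lawSubgroup n) ∧
      ∀ n, ∃ i, compEval l n (FreeGroup.of i) ∉ G.ker := by
  constructor
  · intro hG
    have : Countable G.Carrier := (QuotientGroup.mk_surjective (s := G.ker)).countable
    obtain ⟨l, φ, h⟩ := exists_isLawDescent hG
    obtain ⟨l0, hl0⟩ := h.finitary.eq_evalList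
    choose s hs using QuotientGroup.mk'_surjective G.ker
    let l' : ℕ → List (FreeGroup ℕ) := fun n => Nat.casesOn n (l0.map s) l
    have hφ : ∀ n, (QuotientGroup.mk' G.ker).comp (compEval l' n) = φ n := by
      intro n
      induction n with
      | zero =>
        rw [hl0]
        ext1 i
        change QuotientGroup.mk' G.ker (evalList (l0.map s) _) = _
        rw [evalList_of, evalList_of]
        by_cases hi : i < l0.length
        · rw [List.getD_eq_getElem _ _ hi, List.getD_eq_getElem _ _ (by simpa using hi),
            List.getElem_map, hs]
        · rw [List.getD_eq_default _ _ (not_lt.1 hi),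
            List.getD_eq_default _ _ (by simpa using hi), map_one]
      | succ n ih =>
        rw [h.succ, ← ih]
        rfl
    refine ⟨l', fun n => h.law n, fun n => ?_⟩
    by_contra! hcon
    refine h.ne_one n ?_
    rw [← hφ]
    ext1 i
    exact (QuotientGroup.eq_one_iff _).2 (hcon i)
  · rintro ⟨l, hlaw, hne⟩ hG
    refine hG.not_isLawDescent (fun n => l (n + 1))
      (fun n => (QuotientGroup.mk' G.ker).comp (compEval l n))
      ⟨(isFinitary_evalList _).comp _, fun n => rfl, hlaw, fun n hn => ?_⟩
    obtain ⟨i, hi⟩ := hne n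
    exact hi ((QuotientGroup.eq_one_iff _).1 (DFunLike.congr_fun hn (FreeGroup.of i)))

theorem measurableSet_compEval {α : Type} [MeasurableSpace α] {l : α → ℕ → List (FreeGroup ℕ)}
    (hl : ∀ n u, MeasurableSet {a | l a n = u}) (n : ℕ) :
    ∀ v w, MeasurableSet {a | compEval (l a) n v = w} := by
  induction n with
  | zero =>
    intro v w
    have h : {a | compEval (l a) 0 v = w} = ⋃ u : List (FreeGroup ℕ), ⋃ _ : evalList u v = w,
        {a | l a 0 = u} := by
      ext a
      simp [compEval]
    rw [h]
    exact .iUnion fun u => .iUnion fun _ => hl 0 u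
  | succ n ih =>
    intro v w
    have h : {a | compEval (l a) (n + 1) v = w} = ⋃ u : List (FreeGroup ℕ),
        {a | l a (n + 1) = u} ∩ {a | compEval (l a) n (evalList u v) = w} := by
      ext a
      simp only [Set.mem_iUnion, Set.mem_inter_iff, Set.mem_ofPred_eq, exists_eq_left']
      rfl
    rw [h]
    exact .iUnion fun u => (hl _ u).inter (ih _ _)

/-- A Borel preimage of the set of elementary amenable marked groups is co-analytic. -/
theorem isCoanalyticSubset_preimage {Y : Type} [MeasurableSpace Y] [StandardBorelSpace Y]
    {g : Y → MarkedGroup} (hg : Measurable g) :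
    IsCoanalyticSubset (g ⁻¹' elementaryAmenableMarkedGroups) := by
  obtain ⟨d, hd⟩ := exists_surjective_nat (List (FreeGroup ℕ))
  have hu : Uncountable (ℕ → ℕ) := by
    rw [← Cardinal.aleph0_lt_mk_iff]
    simpa using Cardinal.cantor Cardinal.aleph0
  let l : (ℕ → ℕ) × Y → ℕ → List (FreeGroup ℕ) := fun p n => d (p.1 n)
  have hl : ∀ n (S : Set (List (FreeGroup ℕ))), MeasurableSet {p | l p n ∈ S} := fun n S => by
    have hm : Measurable fun p : (ℕ → ℕ) × Y => p.1 n := by fun_prop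
    exact hm (MeasurableSet.of_discrete (s := d ⁻¹' S))
  refine ⟨ℕ → ℕ, inferInstance, inferInstance, hu, {p | (∀ n, ∀ w ∈ l p (n + 1),
    w ∈ lawSubgroup n) ∧ ∀ n, ∃ i, compEval (l p) n (FreeGroup.of i) ∉ (g p.2).ker}, ?_, ?_⟩
  · refine MeasurableSet.inter (s₁ := {p | ∀ n, ∀ w ∈ l p (n + 1), w ∈ lawSubgroup n})
      (s₂ := {p | ∀ n, ∃ i, compEval (l p) n (FreeGroup.of i) ∉ (g p.2).ker}) ?_ ?_
    · rw [Set.ofPred_forall]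
      exact .iInter fun n => hl (n + 1) {u | ∀ w ∈ u, w ∈ lawSubgroup n}
    · have h : {p | ∀ n, ∃ i, compEval (l p) n (FreeGroup.of i) ∉ (g p.2).ker} =
          ⋂ n, ⋃ i, ⋃ w, {p | compEval (l p) n (FreeGroup.of i) = w} ∩
            (fun p => g p.2) ⁻¹' {G | w ∈ G.ker}ᶜ := by
        ext p
        simp
      rw [h]
      exact .iInter fun n => .iUnion fun i => .iUnion fun w =>
        (measurableSet_compEval (fun n u => hl n {u}) _ _ _).inter
          ((hg.comp measurable_snd) (MarkedGroup.measurableSet_mem_ker w).compl)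
  · ext y
    have hy := not_isElementaryAmenable_iff (g y)
    constructor
    · rintro ⟨⟨x, y⟩, ⟨h1, h2⟩, rfl⟩
      exact (not_isElementaryAmenable_iff (g y)).2 ⟨_, h1, h2⟩
    · intro h
      obtain ⟨u, h1, h2⟩ := hy.1 h
      choose x hx using fun n => hd (u n)
      obtain rfl : (fun n => d (x n)) = u := funext hx
      exact ⟨(x, y), ⟨h1, h2⟩, rfl⟩

/-! ### Borel dependence of the group on the set of nodes -/

/-- The marked group of a set of nodes. -/
noncomputable def treeMarkedGroup (T : Set (List ℕ)) : MarkedGroup :=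
  ⟨(nodeHom T []).ker, inferInstance⟩

theorem treeMarkedGroup_mem_finGen (T : Set (List ℕ)) :
    treeMarkedGroup T ∈ MarkedGroup.finGen := by
  refine ⟨2, by omega, fun i hi => ?_⟩
  change nodeHom T [] (FreeGroup.of i) = 1
  rw [nodeHom, evalList_of, List.getD_eq_default _ _ hi]

theorem treeMarkedGroup_mem_iff {T : Set (List ℕ)} :
    treeMarkedGroup T ∈ elementaryAmenableMarkedGroups ↔ ¬ HasBranch T :=
  (IsElementaryAmenable.carrier_iff_range rfl).trans isElementaryAmenable_nodeHom_iff

theorem treePerm_cons (T : Set (List ℕ)) (s : List ℕ) (a : ℤ × ℕ) (v : List (ℤ × ℕ)) :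
    treePerm T s (a :: v) = a :: treeSection T s a v := by
  rw [← baseAction_treeSection]
  rfl

section Measurability

variable {α : Type} [MeasurableSpace α] {T : α → Set (List ℕ)}

/-- The value at `v` depends on finitely many nodes, at most one per letter. -/
theorem measurableSet_treePerm (hT : ∀ s, MeasurableSet {x | s ∈ T x}) (v : List (ℤ × ℕ)) :
    ∀ s v', MeasurableSet {x | treePerm (T x) s v = v'} := by
  induction v with
  | nil => exact fun s v' => .const ([] = v')
  | cons a v ih =>
    rintro s (_ | ⟨a', v'⟩)
    · convert MeasurableSet.empty (α := α)
      simp [treePerm_cons]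
    · have h : {x | treePerm (T x) s (a :: v) = a' :: v'} = {_x | a = a'} ∩
          (({x | s ++ [a.2] ∈ T x} ∩ ({_x | a.1 = 0} ∩ {x | treePerm (T x) (s ++ [a.2]) v = v'} ∪
            {_x | a.1 ≠ 0 ∧ (if a.1 = a.2 + 1 then shiftGen v else v) = v'})) ∪
          ({x | s ++ [a.2] ∈ T x}ᶜ ∩ {_x | v = v'})) := by
        ext x
        simp only [Set.mem_ofPred_eq, treePerm_cons, treeSection]
        have h4 : (a.2 : ℤ) + 1 ≠ 0 := by omega
        by_cases h1 : s ++ [a.2] ∈ T x <;> by_cases h2 : a.1 = 0 <;>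
          by_cases h3 : a.1 = a.2 + 1 <;> simp [h1, h2, h3, h4]
      rw [h]
      exact (MeasurableSet.const _).inter
        (((hT _).inter (((MeasurableSet.const _).inter (ih _ _)).union (.const _))).union
          ((hT _).compl.inter (.const _)))

theorem measurableSet_nodeHom (hT : ∀ s, MeasurableSet {x | s ∈ T x}) (s : List ℕ)
    (w : FreeGroup ℕ) : ∀ v v', MeasurableSet {x | nodeHom (T x) s w v = v'} := by
  have hgen : ∀ i v v', MeasurableSet {x | nodeHom (T x) s (FreeGroup.of i) v = v'} := by
    intro i v v'
    simp only [nodeHom, evalList_of]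
    rcases i with _ | _ | i
    · exact measurableSet_treePerm hT v s v'
    · exact .const (shiftGen v = v')
    · exact .const (v = v')
  induction w using FreeGroup.induction_on with
  | C1 => simp
  | of i => exact hgen i
  | inv_of i hi =>
    intro v v'
    convert hgen i v' v using 3 with x
    rw [map_inv, Equiv.Perm.inv_eq_iff_eq, eq_comm]
  | mul x y hx hy =>
    intro v v'
    have h : {a | nodeHom (T a) s (x * y) v = v'} =
        ⋃ u, {a | nodeHom (T a) s y v = u} ∩ {a | nodeHom (T a) s x u = v'} := by
      ext a
      simp
    rw [h]
    exact .iUnion fun u => (hy _ _).inter (hx _ _)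

theorem measurable_treeMarkedGroup (hT : ∀ s, MeasurableSet {x | s ∈ T x}) :
    Measurable fun x => treeMarkedGroup (T x) := by
  refine MarkedGroup.measurable_of_mem_ker fun w => ?_
  have h : {x | w ∈ (treeMarkedGroup (T x)).ker} = ⋂ v, {x | nodeHom (T x) [] w v = v} := by
    ext x
    simp only [Set.mem_iInter, Set.mem_ofPred_eq]
    exact Equiv.ext_iff
  rw [h]
  exact .iInter fun v => measurableSet_nodeHom hT [] w v v

end Measurability

/-! ### The diagonal argument -/

/-- The initial segment of length `n` of a sequence. -/
def initSeg (x : ℕ → ℕ) (n : ℕ) : List ℕ := (List.range n).map x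

theorem initSeg_eq_iff {x y : ℕ → ℕ} {n : ℕ} : initSeg x n = initSeg y n ↔ ∀ i < n, x i = y i := by
  simp [initSeg, List.map_inj_left]

theorem length_initSeg (x : ℕ → ℕ) (n : ℕ) : (initSeg x n).length = n := by simp [initSeg]

theorem measurableSet_initSeg (n : ℕ) (s : List ℕ) : MeasurableSet {x | initSeg x n = s} := by
  by_cases h : ∃ y, initSeg y n = s
  · obtain ⟨y, rfl⟩ := h
    have h : {x | initSeg x n = initSeg y n} = ⋂ i, ⋂ _ : i < n, {x | x i = y i} := by
      ext x
      simp [initSeg_eq_iff]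
    rw [h]
    exact .iInter fun i => .iInter fun _ =>
      measurableSet_preimage (measurable_pi_apply (X := fun _ : ℕ => ℕ) i)
        (measurableSet_singleton (y i))
  · convert MeasurableSet.empty
    ext x
    simp only [Set.mem_ofPred_eq, Set.mem_empty_iff_false, iff_false]
    exact fun hx => h ⟨x, hx⟩

theorem tendsto_of_initSeg {x : ℕ → ℕ} {z : ℕ → ℕ → ℕ}
    (h : ∀ n, initSeg (z n) (n + 1) = initSeg x (n + 1)) :
    Filter.Tendsto z Filter.atTop (nhds x) := by
  rw [tendsto_pi_nhds]
  intro i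
  refine tendsto_const_nhds.congr' ?_
  filter_upwards [Filter.eventually_ge_atTop i] with n hn
  exact (initSeg_eq_iff.1 (h n) i (by omega)).symm

/-- The set of nodes that a sequence codes, sectioned at the sequence itself. -/
def diagonalTree (x : ℕ → ℕ) : Set (List ℕ) :=
  {s | x (Encodable.encode (initSeg x s.length, s)) ≠ 0}

theorem measurableSet_mem_diagonalTree (s : List ℕ) : MeasurableSet {x | s ∈ diagonalTree x} := by
  have h : {x | s ∈ diagonalTree x} = ⋃ u : List ℕ, {x | initSeg x s.length = u} ∩
      {x | x (Encodable.encode (u, s)) ≠ 0} := by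
    ext x
    simp [diagonalTree]
  rw [h]
  exact .iUnion fun u => (measurableSet_initSeg _ _).inter
    (measurable_pi_apply _ (measurableSet_singleton 0).compl)

/-- The sequences whose diagonal tree has no branch do not form a Borel set. -/
theorem not_measurableSet_diagonal : ¬ MeasurableSet {x | ¬ HasBranch (diagonalTree x)} := by
  classical
  intro hA
  set A := {x | ¬ HasBranch (diagonalTree x)} with hAdef
  have h := hA.analyticSet
  rw [MeasureTheory.AnalyticSet] at h
  rcases h with h | ⟨f, hf, hfA⟩
  -- The zero sequence codes the empty set of nodes.
  · have : (0 : ℕ → ℕ) ∈ A := fun ⟨y, hy⟩ => hy 0 rfl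
    simp [h] at this
  -- `S` is the tree of the graph of `f`; by continuity its branches over `x` are the points of the
  -- fibre of `f` at `x`.
  let S : Set (List ℕ × List ℕ) := {p | ∃ y, initSeg y p.2.length = p.2 ∧
    initSeg (f y) p.2.length = p.1}
  have hmem : ∀ x, x ∈ A ↔ ∃ y, ∀ n, (initSeg x (n + 1), initSeg y (n + 1)) ∈ S := by
    intro x
    constructor
    · rw [← hfA]
      rintro ⟨y, rfl⟩
      exact ⟨y, fun n => ⟨y, by simp only [length_initSeg], by simp only [length_initSeg]⟩⟩
    · rintro ⟨y, hy⟩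
      choose z hz hfz using hy
      simp only [length_initSeg] at hz hfz
      have h1 := (hf.tendsto y).comp (tendsto_of_initSeg hz)
      have h2 : Filter.Tendsto (f ∘ z) Filter.atTop (nhds x) := tendsto_of_initSeg hfz
      rw [tendsto_nhds_unique h2 h1, ← hfA]
      exact ⟨y, rfl⟩
  -- `x` codes `S` itself, so a branch of its diagonal tree is a witness of `x ∈ A`.
  let x : ℕ → ℕ := fun k => if ∃ p ∈ S, Encodable.encode p = k then 1 else 0
  have hx : ∀ s, s ∈ diagonalTree x ↔ (initSeg x s.length, s) ∈ S := by
    intro s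
    change x _ ≠ 0 ↔ _
    simp only [x, Encodable.encode_inj]
    simp
  have hdiag : x ∈ A ↔ HasBranch (diagonalTree x) := by
    rw [hmem]
    refine exists_congr fun y => forall_congr' fun n => ?_
    change _ ↔ initSeg y (n + 1) ∈ diagonalTree x
    rw [hx, length_initSeg]
  exact iff_not_self (hdiag.symm.trans Iff.rfl)

theorem mainTheorem3 :
    (IsCoanalyticSubset elementaryAmenableMarkedGroups ∧
      ¬ MeasurableSet elementaryAmenableMarkedGroups) ∧
    (IsCoanalyticSubset
        {G : MarkedGroup.finGen | (G : MarkedGroup) ∈ elementaryAmenableMarkedGroups} ∧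
      ¬ MeasurableSet
        {G : MarkedGroup.finGen | (G : MarkedGroup) ∈ elementaryAmenableMarkedGroups}) := by
  have hfg : ¬ MeasurableSet
      {G : MarkedGroup.finGen | (G : MarkedGroup) ∈ elementaryAmenableMarkedGroups} := by
    intro h
    have hm : Measurable fun x =>
        (⟨treeMarkedGroup (diagonalTree x), treeMarkedGroup_mem_finGen _⟩ : MarkedGroup.finGen) :=
      (measurable_treeMarkedGroup measurableSet_mem_diagonalTree).subtype_mk
    refine not_measurableSet_diagonal ?_
    convert hm h using 1
    ext x
    exact treeMarkedGroup_mem_iff.symm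
  exact ⟨⟨isCoanalyticSubset_preimage measurable_id, fun h => hfg (measurable_subtype_coe h)⟩,
    isCoanalyticSubset_preimage measurable_subtype_coe, hfg⟩
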